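/- Let $d\ge 0$ and $n\ge 1$ be integers, let $\beta\in(0,1]$ and $I=[0,1]$. For a $C^n$ map $f:\mathbb R^d\to\mathbb R^d$ put $$\|f\|_{n,\beta}=\max\Big\{\sup_{x\in\mathbb R^d,\,0\le l\le n}\|f^{(l)}(x)\|,\ \sup_{x\ne y}\frac{\|f^{(n)}(x)-f^{(n)}(y)\|}{\|x-y\|^{\beta}}\Big\},$$ with operator norms of multilinear maps with respect to the Euclidean norm. Let $C^{n,\beta}_0=C^{n,\beta}_0(\mathbb R^d,\mathbb R^d)$ be the space of all $C^n$ maps $f$ with $\|f\|_{n,\beta}<\infty$ that tend to $0$ at infinity together with all derivatives up to order $n$, normed by $\|\cdot\|_{n,\beta}$. Let $$\mathcal D^{n,\beta}(\mathbb R^d)=\{\Phi\in \mathrm{Id}+C^{n,\beta}_0:\ \det d\Phi(x)>0\ \text{for all }x\in\mathbb R^d\},\qquad d(\Phi_1,\Phi_2)=\|\Phi_1-\Phi_2\|_{n,\beta},$$ and give $C(I,\mathcal D^{n,\beta}(\mathbb R^d))$ the supremum metric. A pointwise flow of $u:I\times\mathbb R^d\to\mathbb R^d$ is a map $\Phi:I\times\mathbb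 R^d\to\mathbb R^d$ such that, for all $x$, the function $s\mapsto u(s,\Phi(s,x))$ is integrable on $I$ and $\Phi(t,x)=x+\int_0^t u(s,\Phi(s,x))\,ds$ for all $t\in I$. (1) Every $u\in L^1(I,C^{n,\beta}_0)$ (Bochner integrable functions modulo equality a.e., with norm $\int_0^1\|u(t)\|_{n,\beta}\,dt$) has a unique pointwise flow $\Phi$, and $t\mapsto\Phi(t,\cdot)$ belongs to $C(I,\mathcal D^{n,\beta}(\mathbb R^d))$. The flow map $L^1(I,C^{n,\beta}_0)\to C(I,\mathcal D^{n,\beta}(\mathbb R^d))$, $u\mapsto\Phi$, is bounded, i.e. it maps bounded sets to bounded sets. (2) The same holds for pointwise time-dependent $C^{n,\beta}_0$-vector fields, i.e. maps $u:I\times\mathbb R^d\to\mathbb R^d$ such that $u(t,\cdot)\in C^{n,\beta}_0$ for every $t\in I$, $u(\cdot,x)$ is Lebesgue measurable for every $x\in\mathbb R^d$, and $t\mapsto\|u(t,\cdot)\|_{n,\beta}$ is integrable: each has a unique pointwise flow $\Phi$, $t\mapsto\Phi(t,\cdot)$ belongs to $C(I,\mathcal D^{n,\beta}(\mathbb R^d))$,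 and $u\mapsto\Phi$ maps every set of fields on which $\int_0^1\|u(t,\cdot)\|_{n,\beta}\,dt$ is bounded to a bounded set in $C(I,\mathcal D^{n,\beta}(\mathbb R^d))$. -/

import Mathlib

open MeasureTheory Filter Topology
open scoped ENNReal unitInterval

noncomputable section

section HolderSpace

variable {E F : Type*} [NormedAddCommGroup E] [NormedSpace ℝ E]
  [NormedAddCommGroup F] [NormedSpace ℝ F]

/-- `‖f‖_n`: the supremum of the operator norms of `f^{(l)}(x)`, over all `x` and `0 ≤ l ≤ n`,
as an extended nonnegative number. -/
def cnENorm (n : ℕ) (f : E → F) : ℝ≥0∞ :=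
  ⨆ (l : ℕ) (_ : l ≤ n) (x : E), ‖iteratedFDeriv ℝ l f x‖ₑ

/-- `[f]_{n,β}`: the supremum of `‖f^{(n)}(x) - f^{(n)}(y)‖ / ‖x - y‖ ^ β` over all `x ≠ y`,
as an extended nonnegative number. -/
def holderSeminorm (n : ℕ) (β : ℝ) (f : E → F) : ℝ≥0∞ :=
  ⨆ (x : E) (y : E) (_ : x ≠ y),
    ‖iteratedFDeriv ℝ n f x - iteratedFDeriv ℝ n f y‖ₑ / ‖x - y‖ₑ ^ β

/-- `‖f‖_{n,β} = max {‖f‖_n, [f]_{n,β}}`, as an extended nonnegative number. -/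
def holderENorm (n : ℕ) (β : ℝ) (f : E → F) : ℝ≥0∞ :=
  max (cnENorm n f) (holderSeminorm n β f)

lemma enorm_le_holderENorm (n : ℕ) (β : ℝ) (f : E → F) (x : E) :
    ‖f x‖ₑ ≤ holderENorm n β f := by
  have h : ‖f x‖ₑ = ‖iteratedFDeriv ℝ 0 f x‖ₑ := by
    rw [← ofReal_norm, ← ofReal_norm, norm_iteratedFDeriv_zero]
  rw [h]
  exact le_max_of_le_left
    (le_iSup_of_le 0 (le_iSup_of_le (Nat.zero_le n) (le_iSup_of_le x le_rfl)))

lemma holderENorm_zero (n : ℕ) (β : ℝ) : holderENorm n β (0 : E → F) = 0 := by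
  have h (l : ℕ) (x : E) : iteratedFDeriv ℝ l (0 : E → F) x = 0 := by
    rw [iteratedFDeriv_zero]; rfl
  have h0 (l : ℕ) : ‖(0 : E [×l]→L[ℝ] F)‖ₑ = 0 := by rw [← ofReal_norm]; simp
  simp [holderENorm, cnENorm, holderSeminorm, h, h0]

lemma holderENorm_neg (n : ℕ) (β : ℝ) (f : E → F) :
    holderENorm n β (-f) = holderENorm n β f := by
  have h (l : ℕ) (x : E) : iteratedFDeriv ℝ l (-f) x = -iteratedFDeriv ℝ l f x :=
    iteratedFDeriv_neg_apply
  have h2 (x y : E) : ‖-iteratedFDeriv ℝ n f x - -iteratedFDeriv ℝ n f y‖ₑ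
      = ‖iteratedFDeriv ℝ n f x - iteratedFDeriv ℝ n f y‖ₑ := by
    rw [← neg_sub_neg, neg_neg, neg_neg, ← enorm_neg, neg_sub]
  simp only [holderENorm, cnENorm, holderSeminorm, h, enorm_neg, h2]

lemma holderENorm_add_le (n : ℕ) (β : ℝ) {f g : E → F} (hf : ContDiff ℝ n f)
    (hg : ContDiff ℝ n g) :
    holderENorm n β (f + g) ≤ holderENorm n β f + holderENorm n β g := by
  have h (l : ℕ) (hl : l ≤ n) (x : E) : iteratedFDeriv ℝ l (f + g) x
      = iteratedFDeriv ℝ l f x + iteratedFDeriv ℝ l g x :=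
    iteratedFDeriv_add_apply ((hf.of_le (by exact_mod_cast hl)).contDiffAt)
      ((hg.of_le (by exact_mod_cast hl)).contDiffAt)
  have htri (l : ℕ) (a b : E [×l]→L[ℝ] F) : ‖a + b‖ₑ ≤ ‖a‖ₑ + ‖b‖ₑ := by
    simp only [← ofReal_norm]
    rw [← ENNReal.ofReal_add (norm_nonneg _) (norm_nonneg _)]
    exact ENNReal.ofReal_le_ofReal (norm_add_le a b)
  refine max_le (iSup_le fun l => iSup_le fun hl => iSup_le fun x => ?_)
    (iSup_le fun x => iSup_le fun y => iSup_le fun hxy => ?_)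
  · rw [h l hl]
    exact (htri l _ _).trans (add_le_add
      (le_max_of_le_left (le_iSup_of_le l (le_iSup_of_le hl (le_iSup_of_le x le_rfl))))
      (le_max_of_le_left (le_iSup_of_le l (le_iSup_of_le hl (le_iSup_of_le x le_rfl)))))
  · rw [h n le_rfl, h n le_rfl, add_sub_add_comm]
    refine (ENNReal.div_le_div_right (htri n _ _) _).trans ?_
    rw [ENNReal.add_div]
    exact add_le_add
      (le_max_of_le_right (le_iSup_of_le x (le_iSup_of_le y (le_iSup_of_le hxy le_rfl))))
      (le_max_of_le_right (le_iSup_of_le x (le_iSup_of_le y (le_iSup_of_le hxy le_rfl))))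

variable (E F) in
/-- The global Hölder space `C^{n,β}_0(E, F)`: the `C^n` maps `f` with `‖f‖_{n,β} < ∞` which tend
to `0` at infinity together with all their derivatives up to order `n`. -/
@[ext]
structure HolderZero (n : ℕ) (β : ℝ) where
  toFun : E → F
  contDiff : ContDiff ℝ n toFun
  finite : holderENorm n β toFun < ∞
  vanish : ∀ l ≤ n, Tendsto (iteratedFDeriv ℝ l toFun) (Bornology.cobounded E) (𝓝 0)

namespace HolderZero

variable {n : ℕ} {β : ℝ}

instance : CoeFun (HolderZero E F n β) (fun _ => E → F) := ⟨toFun⟩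

lemma toFun_injective : Function.Injective (toFun : HolderZero E F n β → E → F) :=
  fun _ _ h => HolderZero.ext h

instance : Zero (HolderZero E F n β) where
  zero :=
    { toFun := 0
      contDiff := contDiff_const
      finite := by simp [holderENorm_zero]
      vanish := fun l _ => by rw [iteratedFDeriv_zero]; exact tendsto_const_nhds }

instance : Add (HolderZero E F n β) where
  add f g :=
    { toFun := f.toFun + g.toFun
      contDiff := f.contDiff.add g.contDiff
      finite := (holderENorm_add_le n β f.contDiff g.contDiff).trans_lt
        (ENNReal.add_lt_top.2 ⟨f.finite, g.finite⟩)
      vanish := fun l hl => by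
        rw [iteratedFDeriv_add (f.contDiff.of_le (by exact_mod_cast hl))
          (g.contDiff.of_le (by exact_mod_cast hl))]
        have h := (f.vanish l hl).add (g.vanish l hl)
        rw [add_zero] at h
        exact h }

instance : Neg (HolderZero E F n β) where
  neg f :=
    { toFun := -f.toFun
      contDiff := f.contDiff.neg
      finite := by rw [holderENorm_neg]; exact f.finite
      vanish := fun l hl => by
        rw [iteratedFDeriv_neg]
        have h := (f.vanish l hl).neg
        rw [neg_zero] at h
        exact h }

/-- Addition, negation and zero are pointwise. -/
instance : AddCommGroup (HolderZero E F n β) where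
  add_assoc f g h := toFun_injective (add_assoc f.toFun g.toFun h.toFun)
  zero_add f := toFun_injective (zero_add f.toFun)
  add_zero f := toFun_injective (add_zero f.toFun)
  neg_add_cancel f := toFun_injective (neg_add_cancel f.toFun)
  add_comm f g := toFun_injective (add_comm f.toFun g.toFun)
  nsmul := nsmulRec
  zsmul := zsmulRec

/-- The norm of `C^{n,β}_0(E, F)` is `‖·‖_{n,β}`. -/
instance : NormedAddCommGroup (HolderZero E F n β) :=
  AddGroupNorm.toNormedAddCommGroup
    { toFun := fun f => (holderENorm n β f.toFun).toReal
      map_zero' := by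
        change (holderENorm n β (0 : E → F)).toReal = 0
        simp [holderENorm_zero]
      add_le' := fun f g => by
        rw [← ENNReal.toReal_add f.finite.ne g.finite.ne]
        exact ENNReal.toReal_mono (ENNReal.add_ne_top.2 ⟨f.finite.ne, g.finite.ne⟩)
          (holderENorm_add_le n β f.contDiff g.contDiff)
      neg' := fun f => by
        change (holderENorm n β (-f.toFun)).toReal = _
        rw [holderENorm_neg]
      eq_zero_of_map_eq_zero' := fun f hf => by
        have h0 : holderENorm n β f.toFun = 0 :=
          ((ENNReal.toReal_eq_zero_iff _).1 hf).resolve_right f.finite.ne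
        refine toFun_injective (funext fun x => ?_)
        have hx := (enorm_le_holderENorm n β f.toFun x).trans_eq h0
        exact enorm_eq_zero.1 (le_antisymm hx bot_le) }

lemma norm_def (f : HolderZero E F n β) : ‖f‖ = (holderENorm n β f.toFun).toReal := rfl

end HolderZero

end HolderSpace

/-- `ℝ^d` with its Euclidean norm. -/
abbrev Rd (d : ℕ) : Type := EuclideanSpace ℝ (Fin d)

/-- `𝒟^{n,β}(ℝ^d)`: the maps `Φ = Id + φ` with `φ ∈ C^{n,β}_0(ℝ^d, ℝ^d)` and
`det dΦ(x) > 0` for all `x`. Such a map is recorded by its displacement `φ = Φ - Id`. -/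
@[ext]
structure HolderDiffeo (d n : ℕ) (β : ℝ) where
  disp : HolderZero (Rd d) (Rd d) n β
  det_pos : ∀ x : Rd d, 0 < (fderiv ℝ (fun y : Rd d => y + disp y) x).det

namespace HolderDiffeo

variable {d n : ℕ} {β : ℝ}

/-- The element `Φ` of `𝒟^{n,β}(ℝ^d)` as a map: `Φ(x) = x + φ(x)`. -/
instance : CoeFun (HolderDiffeo d n β) (fun _ => Rd d → Rd d) := ⟨fun Φ x => x + Φ.disp x⟩

lemma disp_injective : Function.Injective (disp : HolderDiffeo d n β → _) :=
  fun _ _ h => HolderDiffeo.ext h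

/-- The metric `d(Φ₁, Φ₂) = ‖Φ₁ - Φ₂‖_{n,β}`. -/
instance : MetricSpace (HolderDiffeo d n β) :=
  MetricSpace.induced disp disp_injective inferInstance

lemma dist_def (Φ Ψ : HolderDiffeo d n β) : dist Φ Ψ = ‖Φ.disp - Ψ.disp‖ := by
  change dist Φ.disp Ψ.disp = _
  exact dist_eq_norm _ _

end HolderDiffeo

/-- `L^1([0,1], C^{n,β}_0(ℝ^d, ℝ^d))`: (classes of) Bochner integrable functions, with the norm
`∫₀¹ ‖u(t)‖_{n,β} dt`. -/
abbrev StrongField (d n : ℕ) (β : ℝ) : Type :=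
  Lp (HolderZero (Rd d) (Rd d) n β) 1 (volume : Measure I)

/-- Pointwise time-dependent `C^{n,β}_0`-vector fields: `u(t, ·) ∈ C^{n,β}_0(ℝ^d, ℝ^d)` for every
`t ∈ [0,1]`, `u(·, x)` is (Lebesgue) measurable for every `x`, and `t ↦ ‖u(t, ·)‖_{n,β}` is
integrable. -/
structure PointwiseField (d n : ℕ) (β : ℝ) where
  field : I → HolderZero (Rd d) (Rd d) n β
  aemeasurable_eval : ∀ x : Rd d, AEMeasurable (fun t => field t x) (volume : Measure I)
  integrable_norm : Integrable (fun t => ‖field t‖) (volume : Measure I)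

/-- `∫₀¹ ‖u(t, ·)‖_{n,β} dt`. -/
def PointwiseField.l1Norm {d n : ℕ} {β : ℝ} (u : PointwiseField d n β) : ℝ :=
  ∫ t : I, ‖u.field t‖

/-- `Φ : [0,1] × ℝ^d → ℝ^d` is a pointwise flow of `u : [0,1] × ℝ^d → ℝ^d`:
`Φ(t, x) = x + ∫₀ᵗ u(s, Φ(s, x)) ds` for all `t` and `x` (the integrand being integrable). -/
def IsPointwiseFlow {d : ℕ} (u Φ : I → Rd d → Rd d) : Prop :=
  ∀ x : Rd d, Integrable (fun s => u s (Φ s x)) (volume : Measure I) ∧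
    ∀ t : I, Φ t x = x + ∫ s in Set.Icc 0 t, u s (Φ s x)

/-- `Φ` is the only pointwise flow of `u`. -/
def IsUniquePointwiseFlow {d : ℕ} (u Φ : I → Rd d → Rd d) : Prop :=
  IsPointwiseFlow u Φ ∧ ∀ Ψ : I → Rd d → Rd d, IsPointwiseFlow u Ψ → Ψ = Φ

end

/-! Every estimate is tracked by a predicate `HolderBound n β f M`, and time enters only through the
scalar majorant `g t` of `u t`. Hence measurability of `t ↦ u t x` at each fixed `x` suffices, and a
Bochner field is treated through any representative.

Composition with `Id + φ`, where `φ` is bounded by `M`, multiplies the Hölder bound of a field by a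
constant `compConst n M`. If `compConst n (1/2) * ∫ g ≤ 1/2`, the Picard iterates stay in the ball
of radius `1/2` of `C^{n,β}`, while their increments contract in the sup norm. Pointwise convergence
is then enough, because Hölder balls are closed under pointwise limits (`HolderBound.of_tendsto`).
The derivative of the displacement has norm at most `1/2 < 1`, so the Jacobian is positive. A large
field is cut in time into small pieces whose flows are composed; the number of pieces, hence the
final bound, depends only on a bound for the `L¹` norm.

Uniqueness is Grönwall's lemma with integrable kernel. Decay at infinity follows from dominated
convergence for the displacement, and passes to its derivatives by a compactness argument on
translates. Continuity in time holds because the increment over `(s, t]` has norm at most `compConst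
n R * ∫ g` over that interval. -/

section HolderBound

-- Calculus of Hölder bounds: sums, products, composition.

universe v

variable {E F G H : Type v} [NormedAddCommGroup E] [NormedSpace ℝ E]
  [NormedAddCommGroup F] [NormedSpace ℝ F] [NormedAddCommGroup G] [NormedSpace ℝ G]
  [NormedAddCommGroup H] [NormedSpace ℝ H]

/-- `f` is of class `C^n`, its derivatives up to order `n` are bounded by `M`, and its `n`-th
derivative is `β`-Hölder with constant `M`. -/
def HolderBound (n : ℕ) (β : ℝ) (f : E → F) (M : ℝ) : Prop :=
  ContDiff ℝ n f ∧ (∀ l ≤ n, ∀ x, ‖iteratedFDeriv ℝ l f x‖ ≤ M) ∧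
    ∀ x y, ‖iteratedFDeriv ℝ n f x - iteratedFDeriv ℝ n f y‖ ≤ M * ‖x - y‖ ^ β

namespace HolderBound

variable {n : ℕ} {β A M N : ℝ} {f g : E → F}

lemma norm_le (hf : HolderBound n β f M) (x : E) : ‖f x‖ ≤ M := by
  simpa using hf.2.1 0 (Nat.zero_le n) x

lemma nonneg (hf : HolderBound n β f M) : 0 ≤ M := (norm_nonneg _).trans (hf.norm_le 0)

lemma mono (hf : HolderBound n β f M) (h : M ≤ N) : HolderBound n β f N :=
  ⟨hf.1, fun l hl x => (hf.2.1 l hl x).trans h, fun x y => (hf.2.2 x y).trans (by gcongr)⟩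

lemma zero_iff_of_continuous : HolderBound 0 β f M ↔
    Continuous f ∧ (∀ x, ‖f x‖ ≤ M) ∧ ∀ x y, ‖f x - f y‖ ≤ M * ‖x - y‖ ^ β := by
  have h (x y : E) : ‖iteratedFDeriv ℝ 0 f x - iteratedFDeriv ℝ 0 f y‖ = ‖f x - f y‖ := by
    rw [iteratedFDeriv_zero_eq_comp, Function.comp, Function.comp, ← map_sub,
      LinearIsometryEquiv.norm_map]
  simp only [HolderBound, h, Nat.le_zero, forall_eq, norm_iteratedFDeriv_zero]
  rw [show ((0 : ℕ) : WithTop ℕ∞) = 0 from rfl, contDiff_zero]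

lemma zero_iff (hβ : 0 < β) : HolderBound 0 β f M ↔
    (∀ x, ‖f x‖ ≤ M) ∧ ∀ x y, ‖f x - f y‖ ≤ M * ‖x - y‖ ^ β := by
  rw [zero_iff_of_continuous, and_iff_right_of_imp]
  rintro ⟨-, h⟩
  refine continuous_iff_continuousAt.2 fun x => tendsto_iff_norm_sub_tendsto_zero.2 ?_
  refine squeeze_zero (fun _ => norm_nonneg _) (fun y => h y x) ?_
  have : Continuous fun y : E => M * ‖y - x‖ ^ β :=
    continuous_const.mul ((continuous_id.sub continuous_const).norm.rpow_const
      fun _ => Or.inr hβ.le)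
  simpa [Real.zero_rpow hβ.ne'] using this.tendsto x

/-- Currying the last variable is isometric, so the bound passes to `fderiv ℝ f` unchanged. The
later inductions on `n` replace `F` by `E →L[ℝ] F`, which is why all spaces share one universe. -/
lemma succ_iff : HolderBound (n + 1) β f M ↔
    (∀ x, ‖f x‖ ≤ M) ∧ Differentiable ℝ f ∧ HolderBound n β (fderiv ℝ f) M := by
  have h (x y : E) : ‖iteratedFDeriv ℝ (n + 1) f x - iteratedFDeriv ℝ (n + 1) f y‖
      = ‖iteratedFDeriv ℝ n (fderiv ℝ f) x - iteratedFDeriv ℝ n (fderiv ℝ f) y‖ := by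
    rw [iteratedFDeriv_succ_eq_comp_right, iteratedFDeriv_succ_eq_comp_right, ← dist_eq_norm,
      ← dist_eq_norm]
    exact (continuousMultilinearCurryRightEquiv' ℝ n E F).symm.dist_map _ _
  have h1 : ContDiff ℝ ((n + 1 : ℕ) : WithTop ℕ∞) f ↔
      Differentiable ℝ f ∧ ContDiff ℝ n (fderiv ℝ f) := by
    rw [Nat.cast_add, Nat.cast_one, contDiff_succ_iff_fderiv]
    simp
  simp only [HolderBound, h, h1]
  constructor
  · rintro ⟨⟨h2, h3⟩, h4, h5⟩
    refine ⟨fun x => by simpa using h4 0 (Nat.zero_le _) x, h2, h3, fun l hl x => ?_, h5⟩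
    rw [norm_iteratedFDeriv_fderiv]
    exact h4 _ (by omega) x
  · rintro ⟨h2, h3, h4, h5, h6⟩
    refine ⟨⟨h3, h4⟩, fun l hl x => ?_, h6⟩
    rcases l with _ | l
    · simpa using h2 x
    · rw [← norm_iteratedFDeriv_fderiv]
      exact h5 l (by omega) x

lemma lipschitz (hn : 1 ≤ n) (hf : HolderBound n β f M) (x y : E) :
    ‖f x - f y‖ ≤ M * ‖x - y‖ := by
  obtain ⟨n, rfl⟩ : ∃ k, n = k + 1 := ⟨n - 1, by omega⟩
  obtain ⟨-, hd, hf⟩ := succ_iff.1 hf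
  exact convex_univ.norm_image_sub_le_of_norm_fderiv_le (𝕜 := ℝ) (fun x _ => hd x)
    (fun x _ => hf.norm_le x) (Set.mem_univ _) (Set.mem_univ _)

lemma norm_fderiv_le (hn : 1 ≤ n) (hf : HolderBound n β f M) (x : E) : ‖fderiv ℝ f x‖ ≤ M := by
  have := hf.2.1 1 hn x
  rwa [← zero_add 1, ← norm_iteratedFDeriv_fderiv, norm_iteratedFDeriv_zero] at this

lemma differentiable (hn : 1 ≤ n) (hf : HolderBound n β f M) : Differentiable ℝ f :=
  hf.1.differentiable (by simp; omega)

lemma const (hβ : 0 < β) (c : F) : HolderBound n β (fun _ : E => c) ‖c‖ := by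
  induction n generalizing F with
  | zero =>
    refine (zero_iff hβ).2 ⟨fun _ => le_rfl, fun x y => ?_⟩
    rw [sub_self, norm_zero]
    positivity
  | succ n ih =>
    refine succ_iff.2 ⟨fun _ => le_rfl, differentiable_const c, ?_⟩
    have := ih (0 : E →L[ℝ] F)
    rw [norm_zero] at this
    simp only [fderiv_fun_const]
    exact this.mono (norm_nonneg _)

lemma zero (hβ : 0 < β) : HolderBound n β (fun _ : E => (0 : F)) 0 := by
  simpa using const (E := E) (n := n) hβ (0 : F)

lemma add (hβ : 0 < β) (hf : HolderBound n β f M) (hg : HolderBound n β g N) :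
    HolderBound n β (fun x => f x + g x) (M + N) := by
  induction n generalizing F with
  | zero =>
    rw [zero_iff hβ] at *
    refine ⟨fun x => norm_add_le_of_le (hf.1 x) (hg.1 x), fun x y => ?_⟩
    rw [add_sub_add_comm, add_mul]
    exact norm_add_le_of_le (hf.2 x y) (hg.2 x y)
  | succ n ih =>
    rw [succ_iff] at *
    refine ⟨fun x => norm_add_le_of_le (hf.1 x) (hg.1 x), hf.2.1.add hg.2.1, ?_⟩
    have : fderiv ℝ (fun x => f x + g x) = fun x => fderiv ℝ f x + fderiv ℝ g x :=
      funext fun x => fderiv_fun_add (hf.2.1 x) (hg.2.1 x)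
    rw [this]
    exact ih hf.2.2 hg.2.2

lemma of_succ (hβ : 0 < β) (hβ1 : β ≤ 1) (hf : HolderBound (n + 1) β f M) :
    HolderBound n β f (2 * M) := by
  have hM := hf.nonneg
  induction n generalizing F with
  | zero =>
    refine (zero_iff hβ).2 ⟨fun x => (hf.norm_le x).trans (by linarith), fun x y => ?_⟩
    -- Nearby points use the Lipschitz bound, distant points twice the sup bound; the latter costs
    -- the factor `2`.
    rcases le_total ‖x - y‖ 1 with h | h
    · refine (hf.lipschitz le_rfl x y).trans ?_
      have h1 : ‖x - y‖ ≤ ‖x - y‖ ^ β := Real.self_le_rpow_of_le_one (norm_nonneg _) h hβ1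
      have := norm_nonneg (x - y)
      nlinarith
    · have h1 : 1 ≤ ‖x - y‖ ^ β := Real.one_le_rpow h hβ.le
      have := norm_sub_le_of_le (hf.norm_le x) (hf.norm_le y)
      nlinarith
  | succ n ih =>
    obtain ⟨h1, h2, h3⟩ := succ_iff.1 hf
    exact succ_iff.2 ⟨fun x => (h1 x).trans (by linarith), h2, ih h3⟩

lemma to_zero (hβ : 0 < β) (hβ1 : β ≤ 1) (hf : HolderBound n β f M) :
    HolderBound 0 β f (2 ^ n * M) := by
  induction n generalizing M with
  | zero => simpa using hf
  | succ n ih => exact (ih (hf.of_succ hβ hβ1)).mono (by rw [pow_succ]; linarith)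

/-- Leibniz rule and induction. Each order costs a factor `4`: two terms, and in each the
undifferentiated factor is doubled by `of_succ`. The condition `‖B‖ ≤ 1` is inherited by `precompR`
and `precompL`. -/
lemma bilin (hβ : 0 < β) (hβ1 : β ≤ 1) (B : F →L[ℝ] G →L[ℝ] H) (hB : ‖B‖ ≤ 1) {f : E → F}
    {g : E → G} (hf : HolderBound n β f M) (hg : HolderBound n β g N) :
    HolderBound n β (fun x => B (f x) (g x)) (2 * 4 ^ n * M * N) := by
  have hM := hf.nonneg
  have hN := hg.nonneg
  have hB2 {F G H : Type v} [NormedAddCommGroup F] [NormedSpace ℝ F] [NormedAddCommGroup G]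
      [NormedSpace ℝ G] [NormedAddCommGroup H] [NormedSpace ℝ H] (B : F →L[ℝ] G →L[ℝ] H)
      (hB : ‖B‖ ≤ 1) {a b : ℝ} {x : F} {y : G} (hx : ‖x‖ ≤ a) (hy : ‖y‖ ≤ b) :
      ‖B x y‖ ≤ a * b := by
    refine (B.le_opNorm₂ x y).trans ?_
    have := (norm_nonneg x).trans hx
    calc ‖B‖ * ‖x‖ * ‖y‖ ≤ 1 * a * b := by gcongr
      _ = a * b := by ring
  have hbd (x : E) : ‖B (f x) (g x)‖ ≤ M * N := hB2 B hB (hf.norm_le x) (hg.norm_le x)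
  have hMN := mul_nonneg hM hN
  induction n generalizing F G H M N with
  | zero =>
    rw [zero_iff hβ] at *
    refine ⟨fun x => (hbd x).trans (by linarith), fun x y => ?_⟩
    have e : B (f x) (g x) - B (f y) (g y) = B (f x - f y) (g x) + B (f y) (g x - g y) := by
      simp only [map_sub, sub_apply]
      abel
    rw [e]
    refine (norm_add_le_of_le (hB2 B hB (hf.2 x y) (hg.1 x))
      (hB2 B hB (hf.1 y) (hg.2 x y))).trans (le_of_eq ?_)
    ring
  | succ n ih =>
    have hf' := hf.of_succ hβ hβ1
    have hg' := hg.of_succ hβ hβ1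
    obtain ⟨f1, f2, f3⟩ := succ_iff.1 hf
    obtain ⟨g1, g2, g3⟩ := succ_iff.1 hg
    refine succ_iff.2 ⟨fun x => (hbd x).trans ?_, fun x => ?_, ?_⟩
    · have : (1 : ℝ) ≤ 4 ^ (n + 1) := one_le_pow₀ (by norm_num)
      nlinarith
    · exact (B.hasFDerivAt_of_bilinear (f2 x).hasFDerivAt (g2 x).hasFDerivAt).differentiableAt
    · have e : fderiv ℝ (fun x => B (f x) (g x)) = fun x =>
          B.precompR E (f x) (fderiv ℝ g x) + B.precompL E (fderiv ℝ f x) (g x) :=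
        funext fun x => B.fderiv_of_bilinear (f2 x) (g2 x)
      rw [e]
      have hR := (B.norm_precompR_le E).trans hB
      have hL := (B.norm_precompL_le E).trans hB
      have i1 := ih (B.precompR E) hR hf' g3 hf'.nonneg hN
        (fun x => hB2 _ hR (hf'.norm_le x) (g3.norm_le x)) (mul_nonneg hf'.nonneg hN)
      have i2 := ih (B.precompL E) hL f3 hg' hM hg'.nonneg
        (fun x => hB2 _ hL (f3.norm_le x) (hg'.norm_le x)) (mul_nonneg hM hg'.nonneg)
      exact (i1.add hβ i2).mono (by rw [pow_succ]; linarith)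

end HolderBound

/-- The constant in the estimate of `u ∘ (id + φ)` in `C^{n,β}`, for `φ` bounded by `M`. -/
def compConst : ℕ → ℝ → ℝ
  | 0, M => 1 + M
  | n + 1, M => 1 + 2 * 4 ^ n * (compConst n (2 * M)) * (1 + M)

lemma one_le_compConst {M : ℝ} (hM : 0 ≤ M) (n : ℕ) : 1 ≤ compConst n M := by
  induction n generalizing M with
  | zero => simpa [compConst] using hM
  | succ n ih =>
    rw [compConst]
    have := ih (M := 2 * M) (by linarith)
    have : 0 ≤ 2 * 4 ^ n * (compConst n (2 * M)) * (1 + M) := by positivity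
    linarith

namespace HolderBound

variable {n : ℕ} {β A M N : ℝ}

/-- Chain rule, `bilin` and induction. The Lipschitz hypothesis is kept separately because at order
`0` a merely `β`-Hölder `φ` would degrade the exponent. -/
lemma comp_id_add_of_lipschitz (hβ : 0 < β) (hβ1 : β ≤ 1) {u : E → F} {φ : E → E}
    (hu : HolderBound n β u A) (hφ : HolderBound n β φ M)
    (hK : ∀ x y, ‖φ x - φ y‖ ≤ M * ‖x - y‖) :
    HolderBound n β (fun x => u (x + φ x)) (compConst n M * A) := by
  have hA := hu.nonneg
  have hM := hφ.nonneg
  have h1 := one_le_compConst hM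
  induction n generalizing F M with
  | zero =>
    rw [zero_iff hβ] at *
    refine ⟨fun x => (hu.1 _).trans (le_mul_of_one_le_left hA (h1 0)), fun x y => ?_⟩
    refine (hu.2 _ _).trans ?_
    have h2 : ‖x + φ x - (y + φ y)‖ ≤ (1 + M) * ‖x - y‖ := by
      rw [add_sub_add_comm, add_mul, one_mul]
      exact norm_add_le_of_le le_rfl (hK x y)
    have h3 : (1 + M) ^ β ≤ 1 + M := by
      simpa using Real.rpow_le_rpow_of_exponent_le (by linarith : 1 ≤ 1 + M) hβ1
    calc A * ‖x + φ x - (y + φ y)‖ ^ β ≤ A * ((1 + M) * ‖x - y‖) ^ β := by gcongr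
      _ = A * ((1 + M) ^ β * ‖x - y‖ ^ β) := by
        rw [Real.mul_rpow (by linarith) (norm_nonneg _)]
      _ ≤ A * ((1 + M) * ‖x - y‖ ^ β) := by gcongr
      _ = compConst 0 M * A * ‖x - y‖ ^ β := by rw [compConst]; ring
  | succ n ih =>
    obtain ⟨u1, u2, u3⟩ := succ_iff.1 hu
    obtain ⟨-, φ2, φ3⟩ := succ_iff.1 hφ
    have hd (x : E) : HasFDerivAt (fun x => u (x + φ x))
        (ContinuousLinearMap.compL ℝ E E F (fderiv ℝ u (x + φ x))
          (ContinuousLinearMap.id ℝ E + fderiv ℝ φ x)) x :=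
      (u2 (x + φ x)).hasFDerivAt.comp x ((hasFDerivAt_id x).add (φ2 x).hasFDerivAt)
    refine succ_iff.2 ⟨fun x => (u1 _).trans (le_mul_of_one_le_left hA (h1 _)),
      fun x => (hd x).differentiableAt, ?_⟩
    rw [funext fun x => (hd x).fderiv]
    have hφn : HolderBound n β φ (2 * M) := hφ.of_succ hβ hβ1
    have i1 := ih u3 hφn (fun x y => (hK x y).trans (by gcongr; linarith)) hφn.nonneg
      (one_le_compConst hφn.nonneg)
    have i2 := ((const (E := E) (n := n) hβ (ContinuousLinearMap.id ℝ E)).mono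
      ContinuousLinearMap.norm_id_le).add hβ φ3
    refine (bilin hβ hβ1 _ (ContinuousLinearMap.norm_compL_le ℝ E E F) i1 i2).mono ?_
    rw [compConst]
    linarith

lemma comp_id_add (hβ : 0 < β) (hβ1 : β ≤ 1) (hn : 1 ≤ n) {u : E → F} {φ : E → E}
    (hu : HolderBound n β u A) (hφ : HolderBound n β φ M) :
    HolderBound n β (fun x => u (x + φ x)) (compConst n M * A) :=
  hu.comp_id_add_of_lipschitz hβ hβ1 hφ (hφ.lipschitz hn)

end HolderBound
end HolderBound

/-! ### Hölder bounds under pointwise limits and integrals; decay of derivatives. -/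

section HolderBoundLimit

universe v

variable {E F : Type v} [NormedAddCommGroup E] [NormedSpace ℝ E]
  [NormedAddCommGroup F] [NormedSpace ℝ F]

lemma hasFDerivAt_of_norm_sub_le_rpow {β C : ℝ} (hβ : 0 < β) {f : E → F} {f' : E →L[ℝ] F} {x : E}
    (h : ∀ y, ‖f y - f x - f' (y - x)‖ ≤ C * ‖y - x‖ ^ β * ‖y - x‖) : HasFDerivAt f f' x := by
  rw [hasFDerivAt_iff_isLittleO, Asymptotics.isLittleO_iff]
  intro c hc
  have : Continuous fun y : E => C * ‖y - x‖ ^ β :=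
    continuous_const.mul ((continuous_id.sub continuous_const).norm.rpow_const
      fun _ => Or.inr hβ.le)
  have h0 : Tendsto (fun y : E => C * ‖y - x‖ ^ β) (𝓝 x) (𝓝 0) := by
    simpa [Real.zero_rpow hβ.ne'] using this.tendsto x
  filter_upwards [h0.eventually_lt_const hc] with y hy
  exact (h y).trans (by gcongr)

namespace HolderBound

variable {n : ℕ} {β M : ℝ}

lemma comp_add_right {f : E → F} (hf : HolderBound n β f M) (a : E) :
    HolderBound n β (fun x => f (x + a)) M := by
  refine ⟨hf.1.comp (contDiff_id.add contDiff_const), fun l hl x => ?_, fun x y => ?_⟩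
  · rw [iteratedFDeriv_comp_add_right]
    exact hf.2.1 l hl _
  · rw [iteratedFDeriv_comp_add_right, iteratedFDeriv_comp_add_right]
    simpa using hf.2.2 (x + a) (y + a)

lemma norm_sub_sub_fderiv_le (hβ : 0 < β) (hβ1 : β ≤ 1) {f : E → F}
    (hf : HolderBound (n + 1) β f M) (x y : E) :
    ‖f y - f x - fderiv ℝ f x (y - x)‖ ≤ 2 ^ n * M * ‖y - x‖ ^ β * ‖y - x‖ := by
  have hM := hf.nonneg
  obtain ⟨-, hd, hf'⟩ := succ_iff.1 hf
  have h0 := ((zero_iff hβ).1 (hf'.to_zero hβ hβ1)).2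
  refine (convex_closedBall x ‖y - x‖).norm_image_sub_le_of_norm_fderiv_le' (𝕜 := ℝ)
    (fun z _ => hd z) (fun z hz => (h0 z x).trans ?_) (by simp) (by simp [dist_eq_norm])
  rw [mem_closedBall_iff_norm] at hz
  gcongr

variable {ι : Type*} {f : ι → E → F} {g : E → F}

/-- The first-order Taylor remainder is bounded uniformly in `i`, so the bound survives the limit.
-/
lemma hasFDerivAt_of_tendsto (hβ : 0 < β) (hβ1 : β ≤ 1) {l : Filter ι} [l.NeBot]
    (hf : ∀ i, HolderBound (n + 1) β (f i) M)
    (h : ∀ x, Tendsto (fun i => f i x) l (𝓝 (g x))) {x : E} {g' : E →L[ℝ] F}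
    (hg : Tendsto (fun i => fderiv ℝ (f i) x) l (𝓝 g')) : HasFDerivAt g g' x := by
  refine hasFDerivAt_of_norm_sub_le_rpow hβ (C := 2 ^ n * M) fun y => ?_
  refine le_of_tendsto (((h y).sub (h x)).sub
    ((ContinuousLinearMap.apply ℝ F (y - x)).continuous.tendsto g' |>.comp hg)).norm ?_
  exact Eventually.of_forall fun i => (hf i).norm_sub_sub_fderiv_le hβ hβ1 x y

variable [FiniteDimensional ℝ E] [FiniteDimensional ℝ F]

lemma exists_tendsto_fderiv (U : Ultrafilter ι) (hf : ∀ i, HolderBound (n + 1) β (f i) M) (x : E) :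
    ∃ g' : E →L[ℝ] F, Tendsto (fun i => fderiv ℝ (f i) x) U (𝓝 g') := by
  have : ProperSpace (E →L[ℝ] F) := FiniteDimensional.proper_real _
  obtain ⟨g', -, h⟩ := (isCompact_closedBall (0 : E →L[ℝ] F) M).ultrafilter_le_nhds
    (U.map fun i => fderiv ℝ (f i) x) (by
      rw [le_principal_iff, Ultrafilter.mem_coe, Ultrafilter.mem_map]
      refine Filter.univ_mem' fun i => ?_
      simpa using (hf i).norm_fderiv_le (by omega) x)
  exact ⟨g', h⟩

/-- Along an ultrafilter the bounded derivatives converge at every point at once, with no extraction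
of subsequences, and their limit is the derivative of `g`. -/
lemma of_tendsto (hβ : 0 < β) (hβ1 : β ≤ 1) {l : Filter ι} [l.NeBot]
    (hf : ∀ i, HolderBound n β (f i) M) (h : ∀ x, Tendsto (fun i => f i x) l (𝓝 (g x))) :
    HolderBound n β g M := by
  have hb (x : E) : ‖g x‖ ≤ M :=
    le_of_tendsto (h x).norm (Eventually.of_forall fun i => (hf i).norm_le x)
  induction n generalizing F l with
  | zero =>
    refine (zero_iff hβ).2 ⟨hb, fun x y => ?_⟩
    exact le_of_tendsto ((h x).sub (h y)).norm
      (Eventually.of_forall fun i => ((zero_iff hβ).1 (hf i)).2 x y)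
  | succ n ih =>
    have hU := Ultrafilter.of_le l
    choose g' hg' using exists_tendsto_fderiv (Ultrafilter.of l) hf
    have hd (x : E) := hasFDerivAt_of_tendsto hβ hβ1 hf (fun x => (h x).mono_left hU) (hg' x)
    refine succ_iff.2 ⟨hb, fun x => (hd x).differentiableAt, ?_⟩
    rw [funext fun x => (hd x).fderiv]
    exact ih (fun i => (succ_iff.1 (hf i)).2.2) hg' fun x =>
      le_of_tendsto (hg' x).norm (Eventually.of_forall fun i => (hf i).norm_fderiv_le (by omega) x)

/-- The translates `f (· + a)` tend pointwise to `0` as `a → ∞`, so any limit of their derivatives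
at `0` is the derivative of the zero map. -/
lemma tendsto_fderiv_cobounded (hβ : 0 < β) (hβ1 : β ≤ 1) {f : E → F}
    (hf : HolderBound (n + 1) β f M) (h : Tendsto f (Bornology.cobounded E) (𝓝 0)) :
    Tendsto (fderiv ℝ f) (Bornology.cobounded E) (𝓝 0) := by
  rw [tendsto_iff_ultrafilter]
  intro U hU
  obtain ⟨g', hg'⟩ := exists_tendsto_fderiv U (fun a => hf.comp_add_right a) 0
  have hx (x : E) : Tendsto (fun a => f (x + a)) U (𝓝 0) :=
    h.comp ((tendsto_const_add_cobounded x).mono_left hU)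
  have := (hasFDerivAt_of_tendsto hβ hβ1 (fun a => hf.comp_add_right a) hx hg').unique
    (hasFDerivAt_const (0 : F) (0 : E))
  subst this
  simpa [fderiv_comp_add_right] using hg'

lemma tendsto_iteratedFDeriv_cobounded (hβ : 0 < β) (hβ1 : β ≤ 1) {f : E → F}
    (hf : HolderBound n β f M) (h : Tendsto f (Bornology.cobounded E) (𝓝 0)) {l : ℕ}
    (hl : l ≤ n) : Tendsto (iteratedFDeriv ℝ l f) (Bornology.cobounded E) (𝓝 0) := by
  rw [tendsto_zero_iff_norm_tendsto_zero]
  induction l generalizing F n with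
  | zero => simpa using h.norm
  | succ l ih =>
    obtain ⟨n, rfl⟩ : ∃ k, n = k + 1 := ⟨n - 1, by omega⟩
    simpa only [norm_iteratedFDeriv_fderiv] using ih (succ_iff.1 hf).2.2
      (hf.tendsto_fderiv_cobounded hβ hβ1 h) (by omega)

end HolderBound

lemma aestronglyMeasurable_clm_of_apply [FiniteDimensional ℝ E] {α : Type*} [MeasurableSpace α]
    {μ : Measure α} {A : α → E →L[ℝ] F} (h : ∀ x, AEStronglyMeasurable (fun a => A a x) μ) :
    AEStronglyMeasurable A μ := by
  let b := Module.finBasis ℝ E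
  have e : A = fun a => ∑ i, ContinuousLinearMap.smulRightL ℝ E F
      (LinearMap.toContinuousLinearMap (b.coord i)) (A a (b i)) := by
    funext a
    ext x
    have := congrArg (A a) (b.sum_repr x)
    rw [map_sum] at this
    simpa using this.symm
  rw [e]
  exact Finset.aestronglyMeasurable_fun_sum _ fun i _ =>
    (ContinuousLinearMap.continuous _).comp_aestronglyMeasurable (h (b i))

lemma aestronglyMeasurable_fderiv_apply {α : Type*} [MeasurableSpace α] {μ : Measure α}
    {v : α → E → F} (hd : ∀ a, Differentiable ℝ (v a))
    (h : ∀ x, AEStronglyMeasurable (fun a => v a x) μ) (x e : E) :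
    AEStronglyMeasurable (fun a => fderiv ℝ (v a) x e) μ := by
  refine aestronglyMeasurable_of_tendsto_ae (u := atTop)
    (f := fun (k : ℕ) a => (k : ℝ) • (v a (x + (k : ℝ)⁻¹ • e) - v a x))
    (fun k => ((h _).sub (h x)).const_smul _) (Eventually.of_forall fun a => ?_)
  have := (hd a x).hasFDerivAt.lim_real e
  exact this.comp tendsto_natCast_atTop_atTop

namespace HolderBound

variable {n : ℕ} {β : ℝ} [FiniteDimensional ℝ E] [CompleteSpace F]

/-- Differentiation under the integral sign. Derivatives are measurable in `a` as limits of
difference quotients, so no measurability in a function space is needed. -/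
lemma integral (hβ : 0 < β) {α : Type*} [MeasurableSpace α] {μ : Measure α} {v : α → E → F}
    {m : α → ℝ} (hm : Integrable m μ) (hv : ∀ a, HolderBound n β (v a) (m a))
    (hmeas : ∀ x, AEStronglyMeasurable (fun a => v a x) μ) :
    HolderBound n β (fun x => ∫ a, v a x ∂μ) (∫ a, m a ∂μ) := by
  have hint (x : E) : Integrable (fun a => v a x) μ :=
    hm.mono' (hmeas x) (Eventually.of_forall fun a => (hv a).norm_le x)
  have hb (x : E) : ‖∫ a, v a x ∂μ‖ ≤ ∫ a, m a ∂μ :=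
    norm_integral_le_of_norm_le hm (Eventually.of_forall fun a => (hv a).norm_le x)
  induction n generalizing F with
  | zero =>
    refine (zero_iff hβ).2 ⟨hb, fun x y => ?_⟩
    rw [← integral_sub (hint x) (hint y), ← integral_mul_const]
    exact norm_integral_le_of_norm_le (hm.mul_const _)
      (Eventually.of_forall fun a => ((zero_iff hβ).1 (hv a)).2 x y)
  | succ n ih =>
    have hv' (a : α) := succ_iff.1 (hv a)
    have hmeas' (x : E) : AEStronglyMeasurable (fun a => fderiv ℝ (v a) x) μ :=
      aestronglyMeasurable_clm_of_apply fun e =>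
        aestronglyMeasurable_fderiv_apply (fun a => (hv' a).2.1) hmeas x e
    have hd (x : E) : HasFDerivAt (fun x => ∫ a, v a x ∂μ) (∫ a, fderiv ℝ (v a) x ∂μ) x :=
      hasFDerivAt_integral_of_dominated_of_fderiv_le (bound := m)
        (F' := fun x a => fderiv ℝ (v a) x) univ_mem
        (Eventually.of_forall hmeas) (hint x) (hmeas' x)
        (Eventually.of_forall fun a x _ => (hv' a).2.2.norm_le x) hm
        (Eventually.of_forall fun a x _ => ((hv' a).2.1 x).hasFDerivAt)
    refine succ_iff.2 ⟨hb, fun x => (hd x).differentiableAt, ?_⟩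
    rw [funext fun x => (hd x).fderiv]
    exact ih (fun a => (hv' a).2.2) hmeas'
      (fun x => hm.mono' (hmeas' x) (Eventually.of_forall fun a => (hv' a).2.2.norm_le x))
      fun x => norm_integral_le_of_norm_le hm
        (Eventually.of_forall fun a => (hv' a).2.2.norm_le x)

end HolderBound
end HolderBoundLimit

/-! ### Carathéodory measurability, primitives, Grönwall, Jacobians near the identity. -/

noncomputable section

lemma aestronglyMeasurable_of_caratheodory {α X Y : Type*} [MeasurableSpace α] {μ : Measure α}
    [TopologicalSpace X] [TopologicalSpace Y] [TopologicalSpace.PseudoMetrizableSpace Y] [Zero Y]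
    {u : α → X → Y} (hc : ∀ a, Continuous (u a))
    (hm : ∀ x, AEStronglyMeasurable (fun a => u a x) μ) {p : α → X}
    (hp : AEStronglyMeasurable p μ) : AEStronglyMeasurable (fun a => u a (p a)) μ := by
  obtain ⟨q, hq, hpq⟩ := hp
  suffices h : AEStronglyMeasurable (fun a => u a (q a)) μ from
    h.congr (hpq.mono fun a ha => by simp only [ha])
  refine aestronglyMeasurable_of_tendsto_ae (u := atTop) (f := fun k a => u a (hq.approx k a))
    (fun k => ?_) (Eventually.of_forall fun a => ((hc a).tendsto _).comp (hq.tendsto_approx a))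
  -- On a level set of the simple function the composition is `u · c` with `c` fixed; finitely many
  -- such sets are glued.
  have h (s : Finset X) : AEStronglyMeasurable (fun a => u a (hq.approx k a))
      (μ.restrict (hq.approx k ⁻¹' s)) := by
    classical
    induction s using Finset.induction_on with
    | empty => simp
    | insert c s _ ih =>
      rw [Finset.coe_insert, Set.insert_eq, Set.preimage_union, aestronglyMeasurable_union_iff]
      refine ⟨(hm c).restrict.congr ?_, ih⟩
      filter_upwards [ae_restrict_mem ((hq.approx k).measurableSet_preimage {c})] with a ha
      rw [Set.mem_preimage, Set.mem_singleton_iff] at ha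
      rw [ha]
  have := h (hq.approx k).range
  rwa [SimpleFunc.coe_range, Set.preimage_range, Measure.restrict_univ] at this

section Primitive

variable {F : Type*} [NormedAddCommGroup F] [NormedSpace ℝ F]

lemma setIntegral_Icc_sub_setIntegral_Icc {f : I → F} (hf : Integrable f) {a b : I} (hab : a ≤ b) :
    (∫ s in Set.Icc 0 b, f s) - ∫ s in Set.Icc 0 a, f s = ∫ s in Set.Ioc a b, f s := by
  rw [← Set.Icc_union_Ioc_eq_Icc unitInterval.nonneg' hab, setIntegral_union _ measurableSet_Ioc
    hf.integrableOn hf.integrableOn, add_sub_cancel_left]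
  exact Set.disjoint_left.2 fun x hx hx' => hx'.1.not_ge hx.2

lemma continuous_setIntegral_Icc {f : I → F} (hf : Integrable f) :
    Continuous fun t : I => ∫ s in Set.Icc 0 t, f s := by
  simp_rw [← integral_indicator measurableSet_Icc]
  refine continuous_iff_continuousAt.2 fun t => continuousAt_of_dominated (bound := fun s => ‖f s‖)
    (Eventually.of_forall fun x => hf.1.indicator measurableSet_Icc)
    (Eventually.of_forall fun x => Eventually.of_forall fun s => norm_indicator_le_norm_self _ _)
    hf.norm ?_
  have h : ∀ᵐ s : I, s ≠ t := by simp [ae_iff]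
  filter_upwards [h] with s hs
  rcases hs.lt_or_gt with hs | hs
  · refine continuousAt_const.congr (f := fun _ => f s) ?_
    filter_upwards [lt_mem_nhds hs] with x hx
    exact (Set.indicator_of_mem (show s ∈ Set.Icc 0 x from ⟨unitInterval.nonneg', hx.le⟩) f).symm
  · refine continuousAt_const.congr (f := fun _ => (0 : F)) ?_
    filter_upwards [gt_mem_nhds hs] with x hx
    exact (Set.indicator_of_notMem (fun h => h.2.not_gt hx) f).symm

lemma setIntegral_Icc_zero (f : I → F) : ∫ s in Set.Icc (0 : I) 0, f s = 0 := by
  rw [Set.Icc_self, Measure.restrict_eq_zero.2 (measure_singleton _), integral_zero_measure]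

lemma setIntegral_Icc_one (f : I → F) : ∫ s in Set.Icc (0 : I) 1, f s = ∫ s, f s := by
  rw [show Set.Icc (0 : I) 1 = Set.univ from Set.Icc_bot_top, Measure.restrict_univ]

/-- Grönwall's lemma with an integrable kernel. -/
lemma eq_zero_of_le_setIntegral_mul {g w : I → ℝ} (hg : Integrable g) (hg0 : ∀ t, 0 ≤ g t)
    (hw : Continuous w) (hw0 : ∀ t, 0 ≤ w t)
    (h : ∀ t, w t ≤ ∫ s in Set.Icc 0 t, g s * w s) (t : I) : w t = 0 := by
  set G : I → ℝ := fun t => ∫ s in Set.Icc 0 t, g s with hG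
  have hGmono : Monotone G := fun a b hab =>
    setIntegral_mono_set hg.integrableOn (Eventually.of_forall hg0)
      (Set.Icc_subset_Icc_right hab).eventuallyLE
  have hgw : Integrable fun s => g s * w s := by
    obtain ⟨C, hC⟩ := isCompact_univ.exists_bound_of_continuousOn hw.continuousOn
    exact hg.mul_bdd (c := C) hw.aestronglyMeasurable (Eventually.of_forall fun s => hC s trivial)
  -- Absorption on pieces where `G` grows by at most `1/2`: once `w` vanishes up to level `k / 2`,
  -- its maximum on the next piece is at most half of itself.
  have key (k : ℕ) : ∀ t, G t ≤ k / 2 → w t = 0 := by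
    induction k with
    | zero =>
      intro t ht
      obtain ⟨s, hs, hmax⟩ := isCompact_Icc.exists_isMaxOn
        (⟨0, le_rfl, unitInterval.nonneg'⟩ : (Set.Icc 0 t).Nonempty) hw.continuousOn
      have hst : w t ≤ w s := hmax ⟨unitInterval.nonneg', le_rfl⟩
      have h1 : w t ≤ ∫ r in Set.Icc 0 t, g r * w s :=
        (h t).trans (setIntegral_mono_on hgw.integrableOn (hg.mul_const _).integrableOn
          measurableSet_Icc fun r hr => mul_le_mul_of_nonneg_left (hmax hr) (hg0 r))
      rw [integral_mul_const] at h1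
      have h2 : G t * w s ≤ 0 := mul_nonpos_of_nonpos_of_nonneg (by simpa using ht) (hw0 s)
      exact le_antisymm (h1.trans h2) (hw0 t)
    | succ k ih =>
      intro t ht
      obtain ⟨s, hs, hmax⟩ := isCompact_Icc.exists_isMaxOn
        (⟨0, le_rfl, unitInterval.nonneg'⟩ : (Set.Icc 0 t).Nonempty) hw.continuousOn
      suffices h0 : w s = 0 from
        le_antisymm ((hmax ⟨unitInterval.nonneg', le_rfl⟩).trans_eq h0) (hw0 t)
      rcases le_total (G s) (k / 2) with hk | hk
      · exact ih s hk
      have hk0 : G 0 ≤ k / 2 := by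
        simp only [hG, setIntegral_Icc_zero]
        positivity
      obtain ⟨r, hr, hGr⟩ := intermediate_value_Icc (unitInterval.nonneg' : 0 ≤ s)
        (continuous_setIntegral_Icc hg).continuousOn ⟨hk0, hk⟩
      have h0 : ∫ q in Set.Icc 0 r, g q * w q = 0 :=
        setIntegral_eq_zero_of_forall_eq_zero fun q hq => by
          rw [ih q ((hGmono hq.2).trans_eq hGr), mul_zero]
      have h1 : w s ≤ ∫ q in Set.Ioc r s, g q * w s := by
        refine (h s).trans ?_
        rw [← sub_zero (∫ q in Set.Icc 0 s, g q * w q), ← h0,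
          setIntegral_Icc_sub_setIntegral_Icc hgw hr.2]
        exact setIntegral_mono_on hgw.integrableOn (hg.mul_const _).integrableOn
          measurableSet_Ioc fun q hq => mul_le_mul_of_nonneg_left
            (hmax ⟨unitInterval.nonneg', hq.2.trans hs.2⟩) (hg0 q)
      rw [integral_mul_const, ← setIntegral_Icc_sub_setIntegral_Icc hg hr.2] at h1
      have h2 : G s ≤ (k + 1) / 2 := (hGmono hs.2).trans (by simpa using ht)
      have h3 : G s - G r ≤ 1 / 2 := by
        have : G r = k / 2 := hGr
        linarith
      have h4 : w s ≤ (G s - G r) * w s := h1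
      nlinarith [hw0 s]
  obtain ⟨k, hk⟩ := exists_nat_ge (2 * G t)
  exact key k t (by linarith)

end Primitive

/-- Along the segment from `Id` to `Id + A` the determinant never vanishes, and it starts at `1`. -/
lemma det_one_add_pos {E : Type*} [NormedAddCommGroup E] [NormedSpace ℝ E] [FiniteDimensional ℝ E]
    {A : E →L[ℝ] E} (hA : ‖A‖ < 1) : 0 < (ContinuousLinearMap.id ℝ E + A).det := by
  have hc : Continuous fun s : I => (ContinuousLinearMap.id ℝ E + (s : ℝ) • A).det :=
    ContinuousLinearMap.continuous_det.comp (by fun_prop)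
  have hne (s : I) : (ContinuousLinearMap.id ℝ E + (s : ℝ) • A).det ≠ 0 := by
    intro h
    have := LinearMap.bot_lt_ker_of_det_eq_zero h
    obtain ⟨v, hv, hv0⟩ := (Submodule.ne_bot_iff _).1 this.ne'
    have h1 : v = -((s : ℝ) • A v) := eq_neg_of_add_eq_zero_left hv
    have h2 : ‖v‖ ≤ ‖A v‖ := by
      conv_lhs => rw [h1, norm_neg, norm_smul, Real.norm_of_nonneg s.2.1]
      exact mul_le_of_le_one_left (norm_nonneg _) s.2.2
    have h3 := h2.trans (A.le_opNorm v)
    have h4 := norm_pos_iff.2 hv0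
    nlinarith
  by_contra! hneg
  obtain ⟨s, hs⟩ := mem_range_of_exists_le_of_exists_ge hc (c := 0) ⟨1, by simpa using hneg⟩
    ⟨0, by simp [ContinuousLinearMap.det]⟩
  exact hne s hs

end

/-! ### Existence and uniqueness of flows: Picard iteration and concatenation. -/

noncomputable section

/-- A time-dependent field, measurable in time, with `u(t, ·)` bounded by `g(t)` in `C^{n,β}` for an
integrable function `g`. -/
structure IsHolderField {d : ℕ} (n : ℕ) (β : ℝ) (u : I → Rd d → Rd d) (g : I → ℝ) : Prop where
  bound : ∀ t, HolderBound n β (u t) (g t)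
  meas : ∀ x, AEStronglyMeasurable (fun t => u t x) volume
  integrable : Integrable g

/-- A pointwise flow with displacements bounded by `R` in `C^{n,β}` and positive Jacobians. -/
structure IsHolderFlow {d : ℕ} (n : ℕ) (β : ℝ) (u Φ : I → Rd d → Rd d) (R : ℝ) : Prop where
  flow : IsPointwiseFlow u Φ
  bound : ∀ t, HolderBound n β (fun x => Φ t x - x) R
  det_pos : ∀ t x, 0 < (fderiv ℝ (Φ t) x).det

/-- The displacements of the Picard iterates for the flow of `u`. -/
def picard {d : ℕ} (u : I → Rd d → Rd d) : ℕ → I → Rd d → Rd d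
  | 0 => fun _ _ => 0
  | k + 1 => fun t x => ∫ s in Set.Icc 0 t, u s (x + picard u k s x)

variable {d n : ℕ} {β R : ℝ} {u Φ : I → Rd d → Rd d} {g : I → ℝ}

namespace IsHolderField

lemma nonneg (hu : IsHolderField n β u g) (t : I) : 0 ≤ g t := (hu.bound t).nonneg

lemma setIntegral_le (hu : IsHolderField n β u g) (s : Set I) : ∫ t in s, g t ≤ ∫ t, g t :=
  setIntegral_le_integral hu.integrable (Eventually.of_forall hu.nonneg)

lemma integral_nonneg (hu : IsHolderField n β u g) : 0 ≤ ∫ t, g t :=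
  MeasureTheory.integral_nonneg hu.nonneg

lemma continuous (hn : 1 ≤ n) (hu : IsHolderField n β u g) (t : I) : Continuous (u t) :=
  ((hu.bound t).differentiable hn).continuous

lemma integrable_comp (hn : 1 ≤ n) (hu : IsHolderField n β u g) {p : I → Rd d}
    (hp : AEStronglyMeasurable p volume) : Integrable fun s => u s (p s) :=
  hu.integrable.mono' (aestronglyMeasurable_of_caratheodory (hu.continuous hn) hu.meas hp)
    (Eventually.of_forall fun s => (hu.bound s).norm_le _)

/-- The displacement `∫ u(s, x + φ(s, x)) ds` over a set of times. -/
lemma holderBound_setIntegral (hβ : 0 < β) (hβ1 : β ≤ 1) (hn : 1 ≤ n) (hu : IsHolderField n β u g)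
    {φ : I → Rd d → Rd d} (hφ : ∀ t, HolderBound n β (φ t) R)
    (hφm : ∀ x, AEStronglyMeasurable (fun t => φ t x) volume) (s : Set I) :
    HolderBound n β (fun x => ∫ t in s, u t (x + φ t x)) (compConst n R * ∫ t in s, g t) := by
  rw [← integral_const_mul]
  refine HolderBound.integral hβ (hu.integrable.const_mul _).integrableOn
    (fun t => (hu.bound t).comp_id_add hβ hβ1 hn (hφ t)) fun x => ?_
  exact (hu.integrable_comp hn (aestronglyMeasurable_const.add (hφm x))).1.restrict

/-- Pointwise flows of a field which is Lipschitz in space are unique. -/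
lemma flow_unique (hn : 1 ≤ n) (hu : IsHolderField n β u g) {Ψ : I → Rd d → Rd d}
    (hΦ : IsPointwiseFlow u Φ) (hΨ : IsPointwiseFlow u Ψ) : Ψ = Φ := by
  funext t x
  obtain ⟨h1, h2⟩ := hΦ x
  obtain ⟨h3, h4⟩ := hΨ x
  have hd (t : I) : Ψ t x - Φ t x = ∫ s in Set.Icc 0 t, (u s (Ψ s x) - u s (Φ s x)) := by
    rw [integral_sub h3.integrableOn h1.integrableOn, h2 t, h4 t]
    abel
  have hc : Continuous fun t => ‖Ψ t x - Φ t x‖ := by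
    simp_rw [hd]
    exact (continuous_setIntegral_Icc (h3.sub h1)).norm
  have hint : Integrable fun s => g s * ‖Ψ s x - Φ s x‖ := by
    obtain ⟨C, hC⟩ := isCompact_univ.exists_bound_of_continuousOn hc.continuousOn
    exact hu.integrable.mul_bdd (c := C) hc.aestronglyMeasurable
      (Eventually.of_forall fun s => hC s trivial)
  have := eq_zero_of_le_setIntegral_mul hu.integrable hu.nonneg hc (fun _ => norm_nonneg _)
    (fun t => by
      rw [hd t]
      exact norm_integral_le_of_norm_le hint.integrableOn
        (Eventually.of_forall fun s => (hu.bound s).lipschitz hn _ _)) t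
  exact sub_eq_zero.1 (norm_eq_zero.1 this)

lemma continuous_picard (hβ : 0 < β) (hβ1 : β ≤ 1) (hn : 1 ≤ n) (hu : IsHolderField n β u g)
    (hg : compConst n (1 / 2) * ∫ t, g t ≤ 1 / 2) (k : ℕ) :
    (∀ t, HolderBound n β (picard u k t) (1 / 2)) ∧ ∀ x, Continuous fun t => picard u k t x := by
  have hC := one_le_compConst (by norm_num : (0 : ℝ) ≤ 1 / 2) n
  induction k with
  | zero => exact ⟨fun t => (HolderBound.zero hβ).mono (by norm_num), fun x => continuous_const⟩
  | succ k ih =>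
    refine ⟨fun t => (hu.holderBound_setIntegral hβ hβ1 hn ih.1
      (fun x => (ih.2 x).aestronglyMeasurable) (Set.Icc 0 t)).mono (le_trans ?_ hg), fun x => ?_⟩
    · have := hu.setIntegral_le (Set.Icc 0 t)
      gcongr
    · exact continuous_setIntegral_Icc
        (hu.integrable_comp hn (continuous_const.add (ih.2 x)).aestronglyMeasurable)

lemma exists_flow_of_small (hβ : 0 < β) (hβ1 : β ≤ 1) (hn : 1 ≤ n) (hu : IsHolderField n β u g)
    (hg : compConst n (1 / 2) * ∫ t, g t ≤ 1 / 2) :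
    ∃ Φ : I → Rd d → Rd d, IsHolderFlow n β u Φ (1 / 2) := by
  have hC := one_le_compConst (by norm_num : (0 : ℝ) ≤ 1 / 2) n
  have hg' : ∫ t, g t ≤ 1 / 2 := (le_mul_of_one_le_left hu.integral_nonneg hC).trans hg
  have hP := hu.continuous_picard hβ hβ1 hn hg
  have hI (k : ℕ) (x : Rd d) : Integrable fun s => u s (x + picard u k s x) :=
    hu.integrable_comp hn (continuous_const.add ((hP k).2 x)).aestronglyMeasurable
  -- Contraction in the sup norm only: it uses just the Lipschitz bound of `u` and `∫ g ≤ 1/2`.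
  have hdist (k : ℕ) (t : I) (x : Rd d) :
      ‖picard u (k + 1) t x - picard u k t x‖ ≤ 1 * (1 / 2) ^ k := by
    induction k generalizing t with
    | zero =>
      refine (norm_sub_le_of_le (((hP 1).1 t).norm_le x) (((hP 0).1 t).norm_le x)).trans ?_
      norm_num
    | succ k ih =>
      have e : picard u (k + 2) t x - picard u (k + 1) t x = ∫ s in Set.Icc 0 t,
          (u s (x + picard u (k + 1) s x) - u s (x + picard u k s x)) :=
        (integral_sub (hI (k + 1) x).integrableOn (hI k x).integrableOn).symm
      rw [e]
      refine (norm_integral_le_of_norm_le (g := fun s => g s * (1 * (1 / 2) ^ k))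
        (hu.integrable.mul_const _).integrableOn
        (Eventually.of_forall fun s => ((hu.bound s).lipschitz hn _ _).trans ?_)).trans ?_
      · rw [add_sub_add_left_eq_sub]
        exact mul_le_mul_of_nonneg_left (ih s) (hu.nonneg s)
      · rw [integral_mul_const, pow_succ]
        have h1 := (hu.setIntegral_le (Set.Icc 0 t)).trans hg'
        have h2 : (0 : ℝ) < (1 / 2) ^ k := by positivity
        nlinarith
  have hlim (t : I) (x : Rd d) : ∃ y, Tendsto (fun k => picard u k t x) atTop (𝓝 y) := by
    refine cauchySeq_tendsto_of_complete (cauchySeq_of_le_geometric (1 / 2) 1 (by norm_num)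
      fun k => ?_)
    rw [dist_comm, dist_eq_norm]
    exact hdist k t x
  choose φ hφ using hlim
  have hb (t : I) : HolderBound n β (φ t) (1 / 2) :=
    HolderBound.of_tendsto hβ hβ1 (fun k => (hP k).1 t) (hφ t)
  have hφm (x : Rd d) : AEStronglyMeasurable (fun t => φ t x) volume :=
    aestronglyMeasurable_of_tendsto_ae atTop (fun k => ((hP k).2 x).aestronglyMeasurable)
      (Eventually.of_forall fun t => hφ t x)
  have hflow (t : I) (x : Rd d) : φ t x = ∫ s in Set.Icc 0 t, u s (x + φ s x) := by
    refine tendsto_nhds_unique ((tendsto_add_atTop_iff_nat 1).2 (hφ t x)) ?_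
    exact tendsto_integral_of_dominated_convergence g (fun k => (hI k x).1.restrict)
      hu.integrable.integrableOn
      (fun k => Eventually.of_forall fun s => (hu.bound s).norm_le _)
      (Eventually.of_forall fun s =>
        ((hu.continuous hn s).tendsto _).comp (tendsto_const_nhds.add (hφ s x)))
  refine ⟨fun t x => x + φ t x, fun x => ⟨?_, fun t => ?_⟩, fun t => ?_, fun t x => ?_⟩
  · exact hu.integrable_comp hn (aestronglyMeasurable_const.add (hφm x))
  · rw [← hflow]
  · simpa using hb t
  · have hd : HasFDerivAt (fun x => x + φ t x) (ContinuousLinearMap.id ℝ _ + fderiv ℝ (φ t) x) x :=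
      (hasFDerivAt_id x).add ((hb t).differentiable hn x).hasFDerivAt
    rw [hd.fderiv]
    exact det_one_add_pos (((hb t).norm_fderiv_le hn x).trans_lt (by norm_num))

end IsHolderField

lemma IsHolderField.indicator (hβ : 0 < β) (hu : IsHolderField n β u g) {S : Set I}
    (hS : MeasurableSet S) : IsHolderField n β (S.indicator u) (S.indicator g) where
  bound t := by
    by_cases ht : t ∈ S
    · simpa [ht] using hu.bound t
    · rw [Set.indicator_of_notMem ht, Set.indicator_of_notMem ht]
      exact HolderBound.zero hβ
  meas x := by
    refine ((hu.meas x).indicator hS).congr (Eventually.of_forall fun t => ?_)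
    by_cases ht : t ∈ S <;> simp [ht]
  integrable := hu.integrable.indicator hS

/-- Concatenation of the flow of `u` up to time `τ` with the flow of `u` from time `τ` on. -/
lemma IsPointwiseFlow.comp {τ : I} {Φ₁ Φ₂ : I → Rd d → Rd d}
    (h₁ : IsPointwiseFlow ((Set.Icc 0 τ).indicator u) Φ₁)
    (h₂ : IsPointwiseFlow ((Set.Ioc τ 1).indicator u) Φ₂) :
    IsPointwiseFlow u (fun t x => Φ₂ t (Φ₁ t x)) := by
  have hmem (s : I) : s ∈ Set.Icc 0 τ ↔ s ≤ τ := ⟨fun h => h.2, fun h => ⟨unitInterval.nonneg', h⟩⟩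
  have hmem' (s : I) : s ∈ Set.Ioc τ 1 ↔ τ < s := ⟨fun h => h.1, fun h => ⟨h, unitInterval.le_one'⟩⟩
  -- The first flow is frozen after `τ` and the second is the identity before `τ`.
  have hlate (t : I) (ht : τ ≤ t) (x : Rd d) : Φ₁ t x = Φ₁ τ x := by
    rw [(h₁ x).2 t, (h₁ x).2 τ, add_right_inj, ← sub_eq_zero,
      setIntegral_Icc_sub_setIntegral_Icc (h₁ x).1 ht]
    refine setIntegral_eq_zero_of_forall_eq_zero fun s hs => ?_
    rw [Set.indicator_of_notMem (by rw [hmem]; exact hs.1.not_ge), Pi.zero_apply]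
  have hearly (t : I) (ht : t ≤ τ) (x : Rd d) : Φ₂ t x = x := by
    rw [(h₂ x).2 t, add_eq_left]
    refine setIntegral_eq_zero_of_forall_eq_zero fun s hs => ?_
    rw [Set.indicator_of_notMem (by rw [hmem']; exact (hs.2.trans ht).not_gt), Pi.zero_apply]
  intro x
  have e (s : I) : u s (Φ₂ s (Φ₁ s x)) = (Set.Icc 0 τ).indicator u s (Φ₁ s x) +
      (Set.Ioc τ 1).indicator u s (Φ₂ s (Φ₁ τ x)) := by
    rcases le_or_gt s τ with hs | hs
    · rw [Set.indicator_of_mem ((hmem s).2 hs), Set.indicator_of_notMem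
        (by rw [hmem']; exact hs.not_gt), Pi.zero_apply, add_zero, hearly s hs]
    · rw [Set.indicator_of_mem ((hmem' s).2 hs), Set.indicator_of_notMem
        (by rw [hmem]; exact hs.not_ge), Pi.zero_apply, zero_add, hlate s hs.le]
  simp_rw [e]
  refine ⟨(h₁ x).1.add (h₂ _).1, fun t => ?_⟩
  rw [integral_add (h₁ x).1.integrableOn (h₂ _).1.integrableOn, ← add_assoc, ← (h₁ x).2 t]
  rcases le_total t τ with ht | ht
  · have := (h₂ (Φ₁ τ x)).2 t
    rw [hearly t ht, left_eq_add] at this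
    rw [hearly t ht, this, add_zero]
  · rw [hlate t ht, ← (h₂ (Φ₁ τ x)).2 t]

/-- With displacements `φ₁` and `φ₂`, the composite has displacement `φ₂ ∘ (Id + φ₁) + φ₁`;
determinants multiply. -/
lemma IsHolderFlow.comp (hβ : 0 < β) (hβ1 : β ≤ 1) (hn : 1 ≤ n) {τ : I} {Φ₁ Φ₂ : I → Rd d → Rd d}
    {R₁ R₂ : ℝ} (h₁ : IsHolderFlow n β ((Set.Icc 0 τ).indicator u) Φ₁ R₁)
    (h₂ : IsHolderFlow n β ((Set.Ioc τ 1).indicator u) Φ₂ R₂) :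
    IsHolderFlow n β u (fun t x => Φ₂ t (Φ₁ t x)) (compConst n R₁ * R₂ + R₁) where
  flow := h₁.flow.comp h₂.flow
  bound t := by
    have := ((h₂.bound t).comp_id_add hβ hβ1 hn (h₁.bound t)).add hβ (h₁.bound t)
    simpa using this
  det_pos t x := by
    have hd {u Φ : I → Rd d → Rd d} {R : ℝ} (h : IsHolderFlow n β u Φ R) (x : Rd d) :
        DifferentiableAt ℝ (Φ t) x := by
      simpa using ((h.bound t).differentiable hn x).add differentiableAt_fun_id
    rw [fderiv_fun_comp x (hd h₂ _) (hd h₁ x), ContinuousLinearMap.det,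
      ContinuousLinearMap.toLinearMap_comp, LinearMap.det_comp]
    exact mul_pos (h₂.det_pos t _) (h₁.det_pos t x)

/-- `R` is chosen before `u`: this uniformity gives boundedness of the flow map. Each induction step
splits off a final time interval on which the field is small. -/
lemma exists_isHolderFlow (d : ℕ) (hβ : 0 < β) (hβ1 : β ≤ 1) (hn : 1 ≤ n) (k : ℕ) :
    ∃ R, ∀ (u : I → Rd d → Rd d) (g : I → ℝ), IsHolderField n β u g →
      compConst n (1 / 2) * ∫ t, g t ≤ k / 2 → ∃ Φ, IsHolderFlow n β u Φ R := by
  have hC := one_le_compConst (by norm_num : (0 : ℝ) ≤ 1 / 2) n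
  induction k with
  | zero =>
    exact ⟨1 / 2, fun u g hu hg => hu.exists_flow_of_small hβ hβ1 hn
      (hg.trans (by norm_num))⟩
  | succ k ih =>
    obtain ⟨R, hR⟩ := ih
    refine ⟨compConst n R * (1 / 2) + R, fun u g hu hg => ?_⟩
    obtain ⟨τ, h1, h2⟩ : ∃ τ : I, compConst n (1 / 2) * ∫ t in Set.Icc 0 τ, g t ≤ k / 2 ∧
        compConst n (1 / 2) * ∫ t in Set.Ioc τ 1, g t ≤ 1 / 2 := by
      rcases le_total (compConst n (1 / 2) * ∫ t, g t) (k / 2) with h | h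
      · exact ⟨1, by rwa [setIntegral_Icc_one], by simp⟩
      · obtain ⟨τ, hτ⟩ := mem_range_of_exists_le_of_exists_ge
          ((continuous_setIntegral_Icc hu.integrable).const_mul (compConst n (1 / 2)))
          (c := (k : ℝ) / 2) ⟨0, by rw [setIntegral_Icc_zero, mul_zero]; positivity⟩
          ⟨1, by rwa [setIntegral_Icc_one]⟩
        refine ⟨τ, hτ.le, ?_⟩
        rw [← setIntegral_Icc_sub_setIntegral_Icc hu.integrable unitInterval.le_one',
          setIntegral_Icc_one, mul_sub]
        push_cast at hg
        linarith
    rw [← integral_indicator measurableSet_Icc] at h1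
    rw [← integral_indicator measurableSet_Ioc] at h2
    obtain ⟨Φ₁, hΦ₁⟩ := hR _ _ (hu.indicator hβ measurableSet_Icc) h1
    obtain ⟨Φ₂, hΦ₂⟩ := (hu.indicator hβ measurableSet_Ioc).exists_flow_of_small hβ hβ1 hn h2
    exact ⟨_, hΦ₁.comp hβ hβ1 hn hΦ₂⟩

end

/-! ### From Hölder bounds to curves in the diffeomorphism space; the flow maps. -/

noncomputable section

section HolderZeroNorm

universe v

variable {E F : Type v} [NormedAddCommGroup E] [NormedSpace ℝ E]
  [NormedAddCommGroup F] [NormedSpace ℝ F] {n : ℕ} {β M : ℝ}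

lemma HolderBound.holderENorm_le {f : E → F} (hf : HolderBound n β f M) :
    holderENorm n β f ≤ ENNReal.ofReal M := by
  refine max_le (iSup_le fun l => iSup_le fun hl => iSup_le fun x => ?_)
    (iSup_le fun x => iSup_le fun y => iSup_le fun hxy => ENNReal.div_le_of_le_mul ?_)
  · rw [← ofReal_norm]
    exact ENNReal.ofReal_le_ofReal (hf.2.1 l hl x)
  · have h := norm_pos_iff.2 (sub_ne_zero.2 hxy)
    rw [← ofReal_norm, ← ofReal_norm, ENNReal.ofReal_rpow_of_pos h,
      ← ENNReal.ofReal_mul hf.nonneg]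
    exact ENNReal.ofReal_le_ofReal (hf.2.2 x y)

namespace HolderZero

lemma holderBound (f : HolderZero E F n β) : HolderBound n β f ‖f‖ := by
  have e : holderENorm n β f.toFun = ENNReal.ofReal ‖f‖ :=
    (ENNReal.ofReal_toReal f.finite.ne).symm
  refine ⟨f.contDiff, fun l hl x => ?_, fun x y => ?_⟩
  · rw [← ENNReal.ofReal_le_ofReal_iff (norm_nonneg f), ← e, ofReal_norm]
    exact le_max_of_le_left (le_iSup_of_le l (le_iSup_of_le hl (le_iSup_of_le x le_rfl)))
  · rcases eq_or_ne x y with rfl | hxy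
    · rw [sub_self, norm_zero]
      positivity
    have h := norm_pos_iff.2 (sub_ne_zero.2 hxy)
    rw [← ENNReal.ofReal_le_ofReal_iff (by positivity), ENNReal.ofReal_mul (norm_nonneg f), ← e,
      ← ENNReal.ofReal_rpow_of_pos h, ofReal_norm, ofReal_norm, ← ENNReal.div_le_iff]
    · exact le_max_of_le_right
        (le_iSup_of_le x (le_iSup_of_le y (le_iSup_of_le hxy le_rfl)))
    · rw [← ofReal_norm, ENNReal.ofReal_rpow_of_pos h]
      exact (ENNReal.ofReal_pos.2 (by positivity)).ne'
    · rw [← ofReal_norm, ENNReal.ofReal_rpow_of_pos h]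
      exact ENNReal.ofReal_ne_top

lemma norm_le_of_holderBound {f : HolderZero E F n β} (hf : HolderBound n β f M) : ‖f‖ ≤ M :=
  ENNReal.toReal_le_of_le_ofReal hf.nonneg hf.holderENorm_le

lemma tendsto_cobounded (f : HolderZero E F n β) : Tendsto f (Bornology.cobounded E) (𝓝 0) := by
  have := (f.vanish 0 (Nat.zero_le n)).norm
  simp only [norm_iteratedFDeriv_zero, norm_zero] at this
  exact tendsto_zero_iff_norm_tendsto_zero.2 this

lemma sub_apply (f g : HolderZero E F n β) (x : E) : (f - g) x = f x - g x := by
  rw [sub_eq_add_neg, sub_eq_add_neg]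
  rfl

lemma continuous_eval (x : E) : Continuous fun f : HolderZero E F n β => f x := by
  refine (LipschitzWith.of_dist_le_mul (K := 1) fun f g => ?_).continuous
  rw [dist_eq_norm, dist_eq_norm, ← sub_apply, NNReal.coe_one, one_mul]
  exact (f - g).holderBound.norm_le x

/-- A map bounded in `C^{n,β}` which tends to `0` at infinity, as an element of `C^{n,β}_0`. -/
def ofHolderBound [FiniteDimensional ℝ E] [FiniteDimensional ℝ F] (hβ : 0 < β) (hβ1 : β ≤ 1)
    {f : E → F} (hf : HolderBound n β f M) (h : Tendsto f (Bornology.cobounded E) (𝓝 0)) :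
    HolderZero E F n β where
  toFun := f
  contDiff := hf.1
  finite := hf.holderENorm_le.trans_lt ENNReal.ofReal_lt_top
  vanish _ hl := hf.tendsto_iteratedFDeriv_cobounded hβ hβ1 h hl

end HolderZero
end HolderZeroNorm

variable {d n : ℕ} {β R : ℝ} {u Φ : I → Rd d → Rd d} {g : I → ℝ}

namespace IsHolderFlow

/-- The flow moves points by at most `R`, so `Φ s x` leaves every bounded set with `x`, and
dominated convergence applies with majorant `g`. -/
lemma tendsto_sub_cobounded (hu : IsHolderField n β u g)
    (h0 : ∀ t, Tendsto (u t) (Bornology.cobounded (Rd d)) (𝓝 0)) (hΦ : IsHolderFlow n β u Φ R)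
    (t : I) : Tendsto (fun x => Φ t x - x) (Bornology.cobounded (Rd d)) (𝓝 0) := by
  have : (Bornology.cobounded (Rd d)).IsCountablyGenerated := by
    rw [← comap_norm_atTop]
    infer_instance
  have hcob (s : I) : Tendsto (Φ s) (Bornology.cobounded (Rd d)) (Bornology.cobounded (Rd d)) := by
    rw [← tendsto_norm_atTop_iff_cobounded]
    refine tendsto_atTop_mono (fun x => ?_)
      (tendsto_atTop_add_const_right _ (-R) tendsto_norm_cobounded_atTop)
    have h1 := (hΦ.bound s).norm_le x
    have h2 := norm_sub_norm_le x (Φ s x)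
    rw [norm_sub_rev] at h2
    linarith
  have e (x : Rd d) : Φ t x - x = ∫ s in Set.Icc 0 t, u s (Φ s x) := by
    rw [(hΦ.flow x).2 t, add_sub_cancel_left]
  simp_rw [e]
  rw [← integral_zero I (Rd d) (μ := volume.restrict (Set.Icc 0 t))]
  exact tendsto_integral_filter_of_dominated_convergence g
    (Eventually.of_forall fun x => (hΦ.flow x).1.1.restrict)
    (Eventually.of_forall fun x => Eventually.of_forall fun s => (hu.bound s).norm_le _)
    hu.integrable.integrableOn (Eventually.of_forall fun s => (h0 s).comp (hcob s))

lemma holderBound_sub (hβ : 0 < β) (hβ1 : β ≤ 1) (hn : 1 ≤ n) (hu : IsHolderField n β u g)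
    (hΦ : IsHolderFlow n β u Φ R) {s t : I} (hst : s ≤ t) :
    HolderBound n β (fun x => Φ t x - x - (Φ s x - x))
      (compConst n R * ((∫ r in Set.Icc 0 t, g r) - ∫ r in Set.Icc 0 s, g r)) := by
  have e (x : Rd d) : Φ t x - x - (Φ s x - x) =
      ∫ r in Set.Ioc s t, u r (x + (Φ r x - x)) := by
    simp_rw [add_sub_cancel]
    rw [sub_sub_sub_cancel_right, (hΦ.flow x).2 t, (hΦ.flow x).2 s, add_sub_add_left_eq_sub,
      setIntegral_Icc_sub_setIntegral_Icc (hΦ.flow x).1 hst]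
  rw [setIntegral_Icc_sub_setIntegral_Icc hu.integrable hst, funext e]
  refine hu.holderBound_setIntegral hβ hβ1 hn hΦ.bound (fun x => ?_) _
  have e' (t : I) : Φ t x - x = ∫ s in Set.Icc 0 t, u s (Φ s x) := by
    rw [(hΦ.flow x).2 t, add_sub_cancel_left]
  simp_rw [e']
  exact (continuous_setIntegral_Icc (hΦ.flow x).1).aestronglyMeasurable

lemma exists_continuousMap (hβ : 0 < β) (hβ1 : β ≤ 1) (hn : 1 ≤ n) (hu : IsHolderField n β u g)
    (h0 : ∀ t, Tendsto (u t) (Bornology.cobounded (Rd d)) (𝓝 0)) (hΦ : IsHolderFlow n β u Φ R) :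
    ∃ F : C(I, HolderDiffeo d n β), (fun t x => F t x) = Φ ∧ ∀ t, ‖(F t).disp‖ ≤ R := by
  let φ (t : I) : HolderZero (Rd d) (Rd d) n β :=
    HolderZero.ofHolderBound hβ hβ1 (hΦ.bound t) (hΦ.tendsto_sub_cobounded hu h0 t)
  have hφ (t : I) (x : Rd d) : x + φ t x = Φ t x := add_sub_cancel x (Φ t x)
  let D (t : I) : HolderDiffeo d n β :=
    { disp := φ t
      det_pos := fun x => by simpa only [hφ] using hΦ.det_pos t x }
  have hle {s t : I} (hst : s ≤ t) : dist (D t) (D s) ≤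
      compConst n R * ((∫ r in Set.Icc 0 t, g r) - ∫ r in Set.Icc 0 s, g r) := by
    rw [HolderDiffeo.dist_def]
    refine HolderZero.norm_le_of_holderBound ?_
    rw [funext (HolderZero.sub_apply (D t).disp (D s).disp)]
    exact hΦ.holderBound_sub hβ hβ1 hn hu hst
  have hR : 0 ≤ compConst n R := zero_le_one.trans (one_le_compConst (hΦ.bound 0).nonneg n)
  have hdist (s t : I) : dist (D t) (D s) ≤
      compConst n R * |(∫ r in Set.Icc 0 t, g r) - ∫ r in Set.Icc 0 s, g r| := by
    rcases le_total s t with h | h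
    · exact (hle h).trans (by gcongr; exact le_abs_self _)
    · rw [dist_comm, abs_sub_comm]
      exact (hle h).trans (by gcongr; exact le_abs_self _)
  have hD : Continuous D := by
    refine continuous_iff_continuousAt.2 fun s => tendsto_iff_dist_tendsto_zero.2
      (squeeze_zero (fun _ => dist_nonneg) (hdist s) ?_)
    have : Continuous fun t : I =>
        compConst n R * |(∫ r in Set.Icc 0 t, g r) - ∫ r in Set.Icc 0 s, g r| :=
      continuous_const.mul ((continuous_setIntegral_Icc hu.integrable).sub continuous_const).abs
    simpa using this.tendsto s
  exact ⟨⟨D, hD⟩, funext fun t => funext fun x => hφ t x,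
    fun t => HolderZero.norm_le_of_holderBound (hΦ.bound t)⟩

end IsHolderFlow

lemma PointwiseField.isHolderField (u : PointwiseField d n β) :
    IsHolderField n β (fun t => u.field t) (fun t => ‖u.field t‖) where
  bound t := (u.field t).holderBound
  meas x := (u.aemeasurable_eval x).aestronglyMeasurable
  integrable := u.integrable_norm

/-- Flows of pointwise fields exist, and are bounded in terms of the `L¹` norm of the field. -/
lemma PointwiseField.exists_flow_bound (d : ℕ) (hβ : 0 < β) (hβ1 : β ≤ 1) (hn : 1 ≤ n) (B : ℝ) :
    ∃ R, ∀ u : PointwiseField d n β, u.l1Norm ≤ B → ∃ F : C(I, HolderDiffeo d n β),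
      IsUniquePointwiseFlow (fun t x => u.field t x) (fun t x => F t x) ∧
        ∀ t, ‖(F t).disp‖ ≤ R := by
  obtain ⟨k, hk⟩ := exists_nat_ge (2 * (compConst n (1 / 2) * B))
  obtain ⟨R, hR⟩ := exists_isHolderFlow d hβ hβ1 hn k
  have hC := one_le_compConst (by norm_num : (0 : ℝ) ≤ 1 / 2) n
  refine ⟨R, fun u hu => ?_⟩
  have hB : compConst n (1 / 2) * ∫ t, ‖u.field t‖ ≤ compConst n (1 / 2) * B :=
    mul_le_mul_of_nonneg_left hu (by linarith)
  obtain ⟨Φ, hΦ⟩ := hR _ _ u.isHolderField (by linarith)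
  obtain ⟨F, rfl, hFR⟩ := hΦ.exists_continuousMap hβ hβ1 hn u.isHolderField
    fun t => (u.field t).tendsto_cobounded
  exact ⟨F, ⟨hΦ.flow, fun Ψ hΨ => u.isHolderField.flow_unique hn hΦ.flow hΨ⟩, hFR⟩

lemma IsUniquePointwiseFlow.continuousMap_unique {F F' : C(I, HolderDiffeo d n β)}
    (h : IsUniquePointwiseFlow u fun t x => F t x) (h' : IsUniquePointwiseFlow u fun t x => F' t x) :
    F = F' := by
  have := h'.2 _ h.1
  refine ContinuousMap.ext fun t => HolderDiffeo.disp_injective (HolderZero.toFun_injective ?_)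
  exact funext fun x => add_left_cancel (congrFun (congrFun this t) x)

variable (d n β) in
/-- The identity of `ℝ^d`. -/
def HolderDiffeo.refl : HolderDiffeo d n β where
  disp := 0
  det_pos x := by
    have : (fun y : Rd d => y + (0 : HolderZero (Rd d) (Rd d) n β) y) = id :=
      funext fun y => add_zero y
    rw [this, fderiv_id]
    simp [ContinuousLinearMap.det]

lemma HolderDiffeo.dist_refl (Φ : HolderDiffeo d n β) :
    dist Φ (HolderDiffeo.refl d n β) = ‖Φ.disp‖ := by
  rw [HolderDiffeo.dist_def]
  congr 1
  exact sub_zero _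

/-- The flow map of pointwise fields. -/
lemma PointwiseField.exists_flowMap (d : ℕ) (hβ : 0 < β) (hβ1 : β ≤ 1) (hn : 1 ≤ n) :
    ∃ Fl : PointwiseField d n β → C(I, HolderDiffeo d n β),
      (∀ u : PointwiseField d n β,
        IsUniquePointwiseFlow (fun t x => u.field t x) (fun t x => Fl u t x)) ∧
      ∀ S : Set (PointwiseField d n β),
        BddAbove (PointwiseField.l1Norm '' S) → Bornology.IsBounded (Fl '' S) := by
  have hex (u : PointwiseField d n β) : ∃ F : C(I, HolderDiffeo d n β),
      IsUniquePointwiseFlow (fun t x => u.field t x) (fun t x => F t x) := by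
    obtain ⟨R, hR⟩ := PointwiseField.exists_flow_bound d hβ hβ1 hn u.l1Norm
    obtain ⟨F, hF, -⟩ := hR u le_rfl
    exact ⟨F, hF⟩
  choose Fl hFl using hex
  refine ⟨Fl, hFl, fun S ⟨B, hB⟩ => ?_⟩
  obtain ⟨R, hR⟩ := PointwiseField.exists_flow_bound d hβ hβ1 hn B
  refine (Metric.isBounded_closedBall
    (x := ContinuousMap.const I (HolderDiffeo.refl d n β)) (r := R)).subset ?_
  rintro _ ⟨u, hu, rfl⟩
  -- The chosen `Fl u` carries no uniform bound; uniqueness identifies it with `F`, which does.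
  obtain ⟨F, hF, hFR⟩ := hR u (hB ⟨u, hu, rfl⟩)
  rw [(hFl u).continuousMap_unique hF, Metric.mem_closedBall,
    ContinuousMap.dist_le ((norm_nonneg _).trans (hFR 0))]
  intro t
  rw [ContinuousMap.const_apply, HolderDiffeo.dist_refl]
  exact hFR t

/-- The pointwise field given by a representative of an `L¹` class. -/
def StrongField.toPointwiseField (u : StrongField d n β) : PointwiseField d n β where
  field := u
  aemeasurable_eval x := ((HolderZero.continuous_eval x).comp_aestronglyMeasurable
    (Lp.aestronglyMeasurable u)).aemeasurable
  integrable_norm := (L1.integrable_coeFn u).norm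

lemma StrongField.l1Norm_toPointwiseField (u : StrongField d n β) :
    u.toPointwiseField.l1Norm = ‖u‖ :=
  (L1.norm_eq_integral_norm u).symm

end

theorem mainTheorem8 (d n : ℕ) (hn : 1 ≤ n) (β : ℝ) (hβ0 : 0 < β) (hβ1 : β ≤ 1) :
    (∃ Fl : StrongField d n β → C(I, HolderDiffeo d n β),
      (∀ u : StrongField d n β,
        IsUniquePointwiseFlow (fun t x => u t x) (fun t x => Fl u t x)) ∧
      ∀ S : Set (StrongField d n β), Bornology.IsBounded S → Bornology.IsBounded (Fl '' S)) ∧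
    (∃ Fl : PointwiseField d n β → C(I, HolderDiffeo d n β),
      (∀ u : PointwiseField d n β,
        IsUniquePointwiseFlow (fun t x => u.field t x) (fun t x => Fl u t x)) ∧
      ∀ S : Set (PointwiseField d n β),
        BddAbove (PointwiseField.l1Norm '' S) → Bornology.IsBounded (Fl '' S)) := by
  obtain ⟨Fl, hFl, hb⟩ := PointwiseField.exists_flowMap d hβ0 hβ1 hn
  -- The strong case is the pointwise case for a representative, whose `l1Norm` is the `L¹` norm.
  refine ⟨⟨fun u => Fl u.toPointwiseField, fun u => hFl u.toPointwiseField, fun S hS => ?_⟩,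
    Fl, hFl, hb⟩
  obtain ⟨B, hB⟩ := hS.exists_norm_le
  refine (hb (StrongField.toPointwiseField '' S) ⟨B, ?_⟩).subset ?_
  · rintro _ ⟨_, ⟨u, hu, rfl⟩, rfl⟩
    rw [StrongField.l1Norm_toPointwiseField]
    exact hB u hu
  · rintro _ ⟨u, hu, rfl⟩
    exact ⟨_, ⟨u, hu, rfl⟩, rfl⟩
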